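/- Let $p$ be an odd prime, let $e\equiv 0\pmod 4$ be a positive integer and $q=p^e$. Let $\mathrm{Tr}$ be the absolute trace from $\mathbb{F}_q$ to $\mathbb{F}_p$, let $\eta$ be the quadratic character of $\mathbb{F}_p$, and let $C_0$ and $C_1$ be the sets of squares and of non-squares in $\mathbb{F}_p^*$. For $i\in\{0,1\}$ put $$D_i=\{x\in\mathbb{F}_q:\mathrm{Tr}(x^{p+1}-x)\in C_i\},\qquad \mathcal{C}_{D_i}=\{(\mathrm{Tr}(ax))_{x\in D_i}:a\in\mathbb{F}_q\},$$ a linear code over $\mathbb{F}_p$. Suppose that $\left(\frac{e}{p}\right)=(-1)^{1-i}$. Then the code $\mathcal{C}_{D_i}$ has length $$|D_i|=\frac{p-1}{2}p^{e-1}-\frac{1-\eta(-1)p}{2}p^{e/2}$$ and at most $6$ nonzero weights. If moreover $(p,e)\neq(3,4)$, then it has dimension $e$, and its weight distribution is given by Table A if $p\equiv 1\pmod 4$ and by Table B if $p\equiv 3\pmod 4$: the number of codewords of Hamming weight $w$ is the sum of the multiplicities in the rows whose weight is $w$. Table A (weight: multiplicity): - $0$: $1$ - $\frac{(p-1)^2}{2}p^{e-2}+\frac{(p-1)^2}{2}p^{e/2-1}$: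 $p^e-p^{e-2}$ - $\frac{(p-1)^2}{2}p^{e-2}$: $p^{e-3}-1$ - $\frac{(p-1)^2}{2}p^{e-2}+\frac{p-1}{2}p^{e/2}$: $\frac{p^2-1}{2}p^{e-4}$ - $\frac{(p-1)^2}{2}p^{e-2}+\frac{p-3}{2}p^{e/2}$: $\frac{(p-1)^2}{4}p^{e-4}-\frac{(p-1)^2}{4}p^{e/2-2}$ - $\frac{(p-1)^2}{2}p^{e-2}+\frac{p+1}{2}p^{e/2}$: $\frac{(p-1)^2}{4}p^{e-4}+\frac{(p-1)^2}{4}p^{e/2-2}$ Table B (weight: multiplicity): - $0$: $1$ - $\frac{(p-1)^2}{2}p^{e-2}-\frac{p^2-1}{2}p^{e/2-1}$: $p^e-p^{e-2}$ - $\frac{(p-1)^2}{2}p^{e-2}$: $p^{e-4}-1$ - $\frac{(p-1)^2}{2}p^{e-2}-\frac{p+1}{2}p^{e/2}$: $\frac{p^2-1}{2}p^{e-4}-(p-1)p^{e/2-2}$ - $\frac{(p-1)^2}{2}p^{e-2}-\frac{p+3}{2}p^{e/2}$: $\frac{(p-1)(p-3)}{4}p^{e-4}-\frac{(p-1)(p-3)}{4}p^{e/2-2}$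 - $\frac{(p-1)^2}{2}p^{e-2}-\frac{p-1}{2}p^{e/2}$: $\frac{p^2-1}{4}p^{e-4}+\frac{p^2-1}{4}p^{e/2-2}$ - $\frac{(p-1)^2}{2}p^{e-2}-p^{e/2}$: $(p-1)p^{e-4}$ -/

import Mathlib

/-- The cyclotomic classes of order `2` in `𝔽_p^*`: `C_0` is the set of nonzero squares and `C_1` is
the set of non-squares (which are automatically nonzero). -/
def cyclotomicClass (p : ℕ) (i : Fin 2) : Set (ZMod p) :=
  if i = 0 then {c | c ≠ 0 ∧ IsSquare c} else {c | ¬ IsSquare c}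

open Classical in
/-- The defining set `D_i = {x ∈ F : Tr (x ^ (p + 1) - x) ∈ C_i}`. -/
noncomputable def definingSet (p : ℕ) (F : Type*) [Field F] [Fintype F] [Algebra (ZMod p) F]
    (i : Fin 2) : Finset F :=
  Finset.univ.filter fun x : F =>
    Algebra.trace (ZMod p) F (x ^ (p + 1) - x) ∈ cyclotomicClass p i

/-- The linear map `a ↦ c(a) = (Tr (a x))_{x ∈ D}`. -/
noncomputable def codeword (p : ℕ) {F : Type*} [Field F] [Algebra (ZMod p) F] (D : Finset F) :
    F →ₗ[ZMod p] (D → ZMod p) :=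
  LinearMap.pi fun x : D => (Algebra.trace (ZMod p) F).comp (LinearMap.mulRight (ZMod p) (x : F))

/-- Sanity check: `c(a)` has the coordinates `Tr (a x)`, `x ∈ D`. -/
theorem codeword_apply (p : ℕ) {F : Type*} [Field F] [Algebra (ZMod p) F] (D : Finset F)
    (a : F) (x : D) : codeword p D a x = Algebra.trace (ZMod p) F (a * (x : F)) := rfl

/-- The linear code `C_D = {c(a) : a ∈ F}` over `𝔽_p` with defining set `D`; its length is the
number of elements of `D`. -/
noncomputable def traceCode (p : ℕ) {F : Type*} [Field F] [Algebra (ZMod p) F] (D : Finset F) :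
    Submodule (ZMod p) (D → ZMod p) :=
  LinearMap.range (codeword p D)

/-- `A_w`: the number of codewords of Hamming weight `w` in the code `C`. -/
noncomputable def weightCount {p : ℕ} {ι : Type*} [Fintype ι]
    (C : Submodule (ZMod p) (ι → ZMod p)) (w : ℕ) : ℕ :=
  Set.ncard {c : ι → ZMod p | c ∈ C ∧ hammingNorm c = w}

/-- The multiplicity that a table of rows (weight, multiplicity) gives to the weight `w`: the sum of
the multiplicities of all rows of weight `w` (different rows may happen to have equal weights). -/
def tableMultiplicity (T : List (ℚ × ℚ)) (w : ℕ) : ℚ :=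
  (T.map fun r => if r.1 = (w : ℚ) then r.2 else 0).sum

/-- The weight table for `p ≡ 1 (mod 4)`; rows are (weight, multiplicity). -/
def weightTableOne (p e : ℕ) : List (ℚ × ℚ) :=
  [ (0, 1),
    (((p : ℚ) - 1) ^ 2 / 2 * (p : ℚ) ^ (e - 2) + ((p : ℚ) - 1) ^ 2 / 2 * (p : ℚ) ^ (e / 2 - 1),
      (p : ℚ) ^ e - (p : ℚ) ^ (e - 2)),
    (((p : ℚ) - 1) ^ 2 / 2 * (p : ℚ) ^ (e - 2),
      (p : ℚ) ^ (e - 3) - 1),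
    (((p : ℚ) - 1) ^ 2 / 2 * (p : ℚ) ^ (e - 2) + ((p : ℚ) - 1) / 2 * (p : ℚ) ^ (e / 2),
      ((p : ℚ) ^ 2 - 1) / 2 * (p : ℚ) ^ (e - 4)),
    (((p : ℚ) - 1) ^ 2 / 2 * (p : ℚ) ^ (e - 2) + ((p : ℚ) - 3) / 2 * (p : ℚ) ^ (e / 2),
      ((p : ℚ) - 1) ^ 2 / 4 * (p : ℚ) ^ (e - 4)
        - ((p : ℚ) - 1) ^ 2 / 4 * (p : ℚ) ^ (e / 2 - 2)),
    (((p : ℚ) - 1) ^ 2 / 2 * (p : ℚ) ^ (e - 2) + ((p : ℚ) + 1) / 2 * (p : ℚ) ^ (e / 2),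
      ((p : ℚ) - 1) ^ 2 / 4 * (p : ℚ) ^ (e - 4)
        + ((p : ℚ) - 1) ^ 2 / 4 * (p : ℚ) ^ (e / 2 - 2)) ]

/-- The weight table for `p ≡ 3 (mod 4)`; rows are (weight, multiplicity). -/
def weightTableThree (p e : ℕ) : List (ℚ × ℚ) :=
  [ (0, 1),
    (((p : ℚ) - 1) ^ 2 / 2 * (p : ℚ) ^ (e - 2) - ((p : ℚ) ^ 2 - 1) / 2 * (p : ℚ) ^ (e / 2 - 1),
      (p : ℚ) ^ e - (p : ℚ) ^ (e - 2)),
    (((p : ℚ) - 1) ^ 2 / 2 * (p : ℚ) ^ (e - 2),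
      (p : ℚ) ^ (e - 4) - 1),
    (((p : ℚ) - 1) ^ 2 / 2 * (p : ℚ) ^ (e - 2) - ((p : ℚ) + 1) / 2 * (p : ℚ) ^ (e / 2),
      ((p : ℚ) ^ 2 - 1) / 2 * (p : ℚ) ^ (e - 4) - ((p : ℚ) - 1) * (p : ℚ) ^ (e / 2 - 2)),
    (((p : ℚ) - 1) ^ 2 / 2 * (p : ℚ) ^ (e - 2) - ((p : ℚ) + 3) / 2 * (p : ℚ) ^ (e / 2),
      ((p : ℚ) - 1) * ((p : ℚ) - 3) / 4 * (p : ℚ) ^ (e - 4)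
        - ((p : ℚ) - 1) * ((p : ℚ) - 3) / 4 * (p : ℚ) ^ (e / 2 - 2)),
    (((p : ℚ) - 1) ^ 2 / 2 * (p : ℚ) ^ (e - 2) - ((p : ℚ) - 1) / 2 * (p : ℚ) ^ (e / 2),
      ((p : ℚ) ^ 2 - 1) / 4 * (p : ℚ) ^ (e - 4)
        + ((p : ℚ) ^ 2 - 1) / 4 * (p : ℚ) ^ (e / 2 - 2)),
    (((p : ℚ) - 1) ^ 2 / 2 * (p : ℚ) ^ (e - 2) - (p : ℚ) ^ (e / 2),
      ((p : ℚ) - 1) * (p : ℚ) ^ (e - 4)) ]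

/-!
Let `Q x = Tr (x ^ (q + 1))` over the field `k` of order `q`. Since `1 / 2` polarizes `Q` to the
trace, `Tr (x ^ (q + 1) - x) = Q (x - y) - Q y` with `y = 1 / 2`, and `Q y = e / 4` has the same
quadratic character as the degree `e`. So `D` is the translate by `y` of the elements `u` for which
`Q u - Q y` and `Q y` have opposite quadratic characters, and everything reduces to counting with
`Q`.

As `4 ∣ e`, every element of `k` is a `(q + 1)`-th power in `F`. Hence all nonzero level sets of `Q`
have the same size, which is known up to a sign from their second moment and the radical
`{x | x ^ q ^ 2 = -x}` of order `q ^ 2`; the sign is settled because the nonzero levels are unions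
of cosets of the `(q + 1)`-th roots of unity.

A word given by a functional outside the range of the polar form has the average weight
`(q - 1) / q * |D|`: translations in the radical spread `D` evenly over the values of the
functional. The word given by `polar Q x` meets the level sets of `Q` in numbers found by counting
along the lines of direction `x`, and its weight depends only on `Q x` and `polar Q x y`. Their
joint distribution is governed by the quadratic character of the discriminant of
`Q x * t ^ 2 + polar Q x y * t + Q y`, so the weights come down to character sums of quadratic
polynomials.
-/

section QuadraticCharacter

open Finset

theorem bijective_two_mul_add {k : Type*} [Field k] (h2 : ringChar k ≠ 2) {a : k} (ha : a ≠ 0)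
    (b : k) :
    Function.Bijective fun t : k => 2 * a * t + b :=
  (Equiv.addRight b).bijective.comp
    (mulLeft_bijective₀ _ (mul_ne_zero (Ring.two_ne_zero h2) ha))

variable {k : Type*} [Field k] [Fintype k] [DecidableEq k]

local notation "q" => (Fintype.card k : ℚ)
local notation "η" => quadraticChar k

theorem card_sq_eq (h2 : ringChar k ≠ 2) (a : k) : (#{x | x ^ 2 = a} : ℤ) = η a + 1 := by
  rw [← quadraticChar_card_sqrts h2 a]
  exact congrArg (fun s => (#s : ℤ)) (by ext; simp)

theorem sum_quadraticChar_mul_sub (h2 : ringChar k ≠ 2) {w : k} (hw : w ≠ 0) :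
    ∑ s, η (s * (s - w)) = -1 := by
  have jacobi : ∑ s, η s * η (1 - s) = -η (-1) := by
    have h := jacobiSum_nontrivial_inv (quadraticChar_ne_one h2)
    rwa [(quadraticChar_isQuadratic k).inv] at h
  calc ∑ s, η (s * (s - w))
      = ∑ s, η (-1) * (η s * η (1 - s)) := by
        refine (Fintype.sum_bijective _ (mulLeft_bijective₀ w hw) _ _ fun s => ?_).symm
        have factor : w * s * (w * s - w) = w ^ 2 * (-1 * (s * (1 - s))) := by ring
        rw [← map_mul, ← map_mul, factor, map_mul η (w ^ 2), quadraticChar_sq_one' hw, one_mul]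
    _ = -1 := by
        rw [← mul_sum, jacobi, mul_neg, ← sq, quadraticChar_sq_one (neg_ne_zero.mpr one_ne_zero)]

theorem sum_quadraticChar_sq_sub (h2 : ringChar k ≠ 2) (w : k) :
    ∑ t, η (t ^ 2 - w) = if w = 0 then (Fintype.card k : ℤ) - 1 else -1 := by
  have translate : ∑ s, η (s - w) = 0 := by
    rw [← quadraticChar_sum_zero h2]
    exact Equiv.sum_comp (Equiv.subRight w) η
  calc ∑ t, η (t ^ 2 - w)
      = ∑ s, (η s + 1) * η (s - w) := by
        rw [← sum_fiberwise' univ (fun t : k => t ^ 2) fun s => η (s - w)]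
        exact sum_congr rfl fun s _ => by rw [sum_const, nsmul_eq_mul, card_sq_eq h2]
    _ = ∑ s, η (s * (s - w)) := by
        simp only [add_mul, one_mul, sum_add_distrib, translate, add_zero, map_mul]
    _ = if w = 0 then (Fintype.card k : ℤ) - 1 else -1 := by
        split_ifs with hw
        · have h (s : k) : η (s * (s - w)) = 1 - if s = 0 then 1 else 0 := by
            by_cases hs : s = 0
            · simp [hs]
            · simp [hw, hs, ← sq, quadraticChar_sq_one' hs, -map_mul]
          simp [h, -map_mul]
        · exact sum_quadraticChar_mul_sub h2 hw

theorem sum_quadraticChar_quadratic (h2 : ringChar k ≠ 2) {a : k} (ha : a ≠ 0) (b c : k) :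
    ∑ t, η (a * t ^ 2 + b * t + c)
      = η a * if discrim a b c = 0 then (Fintype.card k : ℤ) - 1 else -1 := by
  rw [← sum_quadraticChar_sq_sub h2, mul_sum]
  refine Fintype.sum_bijective _ (bijective_two_mul_add h2 ha b) _ _ fun t => ?_
  have complete_square : a * ((2 * a * t + b) ^ 2 - discrim a b c)
      = (2 * a) ^ 2 * (a * t ^ 2 + b * t + c) := by
    rw [discrim]
    ring
  rw [← map_mul, complete_square, map_mul, quadraticChar_sq_one'
    (mul_ne_zero (Ring.two_ne_zero h2) ha), one_mul]

theorem card_roots_quadratic (h2 : ringChar k ≠ 2) {a : k} (ha : a ≠ 0) (b c : k) :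
    (#{t | a * t ^ 2 + b * t + c = 0} : ℤ) = 1 + η (discrim a b c) := by
  have : NeZero (2 : k) := ⟨Ring.two_ne_zero h2⟩
  rw [add_comm, ← card_sq_eq h2]
  exact_mod_cast card_bijective _ (bijective_two_mul_add h2 ha b) fun t => by
    simp only [mem_filter_univ, sq t, quadratic_eq_zero_iff_discrim_eq_sq ha, eq_comm]

theorem sum_comp_quadraticChar {ι : Type*} [Fintype ι] (g : ι → k) (Φ : ℤ → ℚ) :
    ∑ x, Φ (η (g x))
      = #{x | g x = 0} * Φ 0
        + (Fintype.card ι - #{x | g x = 0} + ∑ x, η (g x) : ℤ) / 2 * Φ 1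
        + (Fintype.card ι - #{x | g x = 0} - ∑ x, η (g x) : ℤ) / 2 * Φ (-1) := by
  have pointwise (x : ι) : Φ (η (g x)) = (if g x = 0 then 1 else 0) * Φ 0
      + (1 - (if g x = 0 then 1 else 0) + (η (g x) : ℚ)) / 2 * Φ 1
      + (1 - (if g x = 0 then 1 else 0) - (η (g x) : ℚ)) / 2 * Φ (-1) := by
    by_cases hx : g x = 0
    · simp [hx]
    · rcases quadraticChar_dichotomy hx with h | h <;> norm_num [hx, h]
  rw [sum_congr rfl fun x _ => pointwise x]
  simp only [sum_add_distrib, sum_sub_distrib, ← sum_mul, ← sum_div, natCast_card_filter,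
    sum_const, card_univ, nsmul_one]
  push_cast
  ring

theorem two_mul_card_quadraticChar_eq {ι : Type*} [Fintype ι] (g : ι → k) {ε : ℤ}
    (hε : IsUnit ε) :
    2 * (#{x | η (g x) = ε} : ℚ)
      = (Fintype.card ι - #{x | g x = 0} + ε * ∑ x, η (g x) : ℤ) := by
  rw [natCast_card_filter, sum_comp_quadraticChar g fun z => if z = ε then 1 else 0]
  rcases Int.isUnit_iff.mp hε with rfl | rfl <;> norm_num <;> ring

theorem sum_comp_quadraticChar_sq_sub (h2 : ringChar k ≠ 2) {w : k} (hw : w ≠ 0) (Φ : ℤ → ℚ) :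
    ∑ t, Φ (η (t ^ 2 - w))
      = (1 + η w) * Φ 0 + (q - 2 - η w) / 2 * Φ 1 + (q - η w) / 2 * Φ (-1) := by
  rw [sum_comp_quadraticChar, sum_quadraticChar_sq_sub h2, if_neg hw]
  simp only [sub_eq_zero]
  have roots := congrArg (Int.cast : ℤ → ℚ) (card_sq_eq h2 w)
  push_cast at roots ⊢
  rw [roots]
  ring

theorem sum_erase_comp_quadraticChar_mul (h2 : ringChar k ≠ 2) {c : k} (hc : c ≠ 0) (Φ : ℤ → ℚ) :
    ∑ v ∈ univ.erase 0, Φ (η (v * c)) = (q - 1) / 2 * (Φ 1 + Φ (-1)) := by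
  have root : #{v | v * c = 0} = 1 := by simp [hc, filter_eq']
  have cancel : ∑ v, η (v * c) = 0 := by
    simp only [map_mul, ← sum_mul, quadraticChar_sum_zero h2, zero_mul]
  rw [sum_erase_eq_sub (mem_univ 0), sum_comp_quadraticChar, root, cancel, zero_mul,
    quadraticChar_zero]
  push_cast
  ring

theorem sum_comp_quadraticChar_discrim (h2 : ringChar k ≠ 2) {c : k} (hc : c ≠ 0)
    (G : ℤ → ℤ → ℚ) :
    ∑ v ∈ univ.erase 0, ∑ t, G (η (v * c)) (η (discrim v t c))
      = (q - 1) / 2 * (2 * G 1 0 + (q - 3) / 2 * G 1 1 + (q - 1) / 2 * G 1 (-1)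
          + (q - 1) / 2 * G (-1) 1 + (q + 1) / 2 * G (-1) (-1)) := by
  have inner (v : k) (hv : v ∈ univ.erase 0) : ∑ t, G (η (v * c)) (η (discrim v t c))
      = (1 + η (v * c)) * G (η (v * c)) 0 + (q - 2 - η (v * c)) / 2 * G (η (v * c)) 1
        + (q - η (v * c)) / 2 * G (η (v * c)) (-1) := by
    have h4 : 4 * v * c = 2 ^ 2 * (v * c) := by ring
    have h4_ne : 4 * v * c ≠ 0 := h4 ▸ mul_ne_zero (pow_ne_zero 2 (Ring.two_ne_zero h2))
      (mul_ne_zero (ne_of_mem_erase hv) hc)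
    have h4_char : η (4 * v * c) = η (v * c) := by
      rw [h4, map_mul, quadraticChar_sq_one' (Ring.two_ne_zero h2), one_mul]
    simp only [discrim, sum_comp_quadraticChar_sq_sub h2 h4_ne, h4_char]
  rw [sum_congr rfl inner, sum_erase_comp_quadraticChar_mul h2 hc fun α =>
    (1 + α) * G α 0 + (q - 2 - α) / 2 * G α 1 + (q - α) / 2 * G α (-1)]
  push_cast
  ring

/-- The elements `s` such that `s - c` and `c` have opposite quadratic characters: for `c ≠ 0`,
`s - c` is nonzero and exactly one of `s - c` and `c` is a square. -/
def oppositeClass (c : k) : Finset k := {s | η (s - c) = -η c}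

theorem mem_oppositeClass {c s : k} : s ∈ oppositeClass c ↔ η (s - c) = -η c := by
  simp [oppositeClass]

variable {c : k} (hc : c ≠ 0)
include hc

theorem isUnit_neg_quadraticChar : IsUnit (-η c) :=
  (hc.isUnit.map η).neg

theorem card_oppositeClass (h2 : ringChar k ≠ 2) : (#(oppositeClass c) : ℚ) = (q - 1) / 2 := by
  have root : #{s | s - c = 0} = 1 := by simp [sub_eq_zero, filter_eq']
  have cancel : ∑ s, η (s - c) = 0 := by
    rw [← quadraticChar_sum_zero h2]
    exact Equiv.sum_comp (Equiv.subRight c) η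
  have h := two_mul_card_quadraticChar_eq (fun s => s - c) (isUnit_neg_quadraticChar hc)
  rw [root, cancel] at h
  push_cast at h
  rw [oppositeClass]
  linear_combination h / 2

theorem ite_zero_mem_oppositeClass :
    (if 0 ∈ oppositeClass c then 1 else 0 : ℚ) = (1 - η (-1)) / 2 := by
  have factor : η (0 - c) = η (-1) * η c := by rw [← map_mul, neg_one_mul, zero_sub]
  simp only [mem_oppositeClass, factor]
  rcases quadraticChar_dichotomy hc with h | h <;>
    rcases quadraticChar_dichotomy (neg_ne_zero.mpr (one_ne_zero (α := k))) with h' | h' <;>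
    norm_num [h, h']

theorem two_mul_card_quadratic_mem_oppositeClass (h2 : ringChar k ≠ 2) {v : k} (hv : v ≠ 0)
    (t : k) :
    2 * (#{r | r * t - r ^ 2 * v ∈ oppositeClass c} : ℚ)
      = q - 1 - η (discrim v t c)
        - η (-1) * η (v * c) * if η (discrim v t c) = 0 then q - 1 else -1 := by
  have arg (r : k) : r * t - r ^ 2 * v - c = -v * r ^ 2 + t * r + -c := by ring
  have disc : discrim (-v) t (-c) = discrim v t c := by simp [discrim]
  have lead : η (-v) = η (-1) * η v := by rw [← map_mul, neg_one_mul]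
  simp only [mem_oppositeClass, arg]
  rw [two_mul_card_quadraticChar_eq _ (isUnit_neg_quadraticChar hc),
    card_roots_quadratic h2 (neg_ne_zero.mpr hv),
    sum_quadraticChar_quadratic h2 (neg_ne_zero.mpr hv), disc, lead, map_mul]
  simp only [quadraticChar_eq_zero_iff]
  push_cast
  ring

end QuadraticCharacter

section LevelSets

open Finset
open QuadraticMap (polar polar_comm polar_smul_right polarBilin_apply_apply)

theorem polarBilin_flip {R M N : Type*} [CommRing R] [AddCommGroup M] [Module R M]
    [AddCommGroup N] [Module R N] (Q : QuadraticMap R M N) : Q.polarBilin.flip = Q.polarBilin :=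
  LinearMap.ext₂ fun x y => polar_comm Q y x

theorem map_add_smul {R M : Type*} [CommRing R] [AddCommGroup M] [Module R M]
    (Q : QuadraticForm R M) (u x : M) (t : R) :
    Q (u + t • x) = Q u + t * polar Q x u + t ^ 2 * Q x := by
  rw [QuadraticMap.map_add Q, QuadraticMap.map_smul, polar_smul_right, polar_comm Q u x]
  simp only [smul_eq_mul]
  ring

theorem range_polarBilin {k V : Type*} [Field k] [AddCommGroup V] [Module k V]
    [FiniteDimensional k V] (Q : QuadraticForm k V) :
    Q.polarBilin.range = Q.polarBilin.ker.dualAnnihilator := by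
  rw [LinearMap.dualAnnihilator_ker_eq_range_flip, polarBilin_flip]

theorem map_eq_zero_of_mem_ker_polarBilin {k V : Type*} [Field k] [AddCommGroup V] [Module k V]
    {Q : QuadraticForm k V} (h2 : ringChar k ≠ 2) {x : V} (hx : x ∈ Q.polarBilin.ker) :
    Q x = 0 := by
  let _ : Invertible (2 : k) := invertibleOfNonzero (Ring.two_ne_zero h2)
  exact (Q.radical_eq_ker_polarBilin.ge hx).1

theorem sum_sq_card_fiber {G β : Type*} [AddGroup G] [Fintype G] [Fintype β] [DecidableEq β]
    (f : G → β) : ∑ b, #{u | f u = b} ^ 2 = ∑ a, #{u | f (a + u) = f u} := by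
  calc ∑ b, #{u | f u = b} ^ 2
      = ∑ b, ∑ u with f u = b, #{v | f v = f u} := by
        refine sum_congr rfl fun b _ => ?_
        rw [sq, ← smul_eq_mul, ← sum_const]
        exact sum_congr rfl fun u hu => by rw [(mem_filter.mp hu).2]
    _ = ∑ u, #{v | f v = f u} := sum_fiberwise _ _ _
    _ = ∑ u, #{a | f (a + u) = f u} :=
        sum_congr rfl fun u _ => (card_equiv (Equiv.addRight u) (by simp)).symm
    _ = ∑ a, #{u | f (a + u) = f u} := by
        simp only [card_filter]
        exact sum_comm

open Classical in
theorem sum_comp_linearMap {R M N : Type*} [Ring R] [AddCommGroup M] [Module R M]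
    [AddCommGroup N] [Module R N] [Fintype M] [Fintype N] (f : M →ₗ[R] N) (g : N → ℚ) :
    ∑ x, g (f x) = Nat.card f.ker * ∑ b with b ∈ f.range, g b := by
  have fiber (b : N) : (#{x | f x = b} : ℚ) = if b ∈ f.range then (Nat.card f.ker : ℚ) else 0 := by
    split_ifs with hb
    · have zero_mem : (0 : N) ∈ f.range := zero_mem _
      rw [AddMonoidHom.card_fiber_eq_of_mem_range f hb zero_mem,
        Nat.card_eq_fintype_card, Fintype.card_subtype]
      rfl
    · rw [Nat.cast_eq_zero, card_eq_zero, filter_eq_empty_iff]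
      exact fun x _ hx => hb ⟨x, hx⟩
  rw [← sum_fiberwise' univ f g, mul_sum, sum_filter]
  refine sum_congr rfl fun b _ => ?_
  rw [sum_const, nsmul_eq_mul, fiber, ite_mul, zero_mul]

variable {k V : Type*} [Field k] [Fintype k] [DecidableEq k] [AddCommGroup V] [Module k V]
  [Fintype V]

local notation "q" => (Fintype.card k : ℚ)

theorem card_mul_card_fiber_of_invariant (P : V → Prop) [DecidablePred P] {x : V}
    (hP : ∀ (t : k) (u : V), P (u + t • x) ↔ P u) {l : Module.Dual k V} (hl : l x ≠ 0) (r : k) :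
    q * #{u | P u ∧ l u = r} = #{u | P u} := by
  have translate (r' : k) : #{u | P u ∧ l u = r'} = #{u | P u ∧ l u = r} := by
    refine card_equiv (Equiv.addRight (((r - r') / l x) • x)) fun u => ?_
    simp only [mem_filter, mem_univ, true_and, Equiv.coe_addRight, hP, map_add, map_smul,
      smul_eq_mul, div_mul_cancel₀ _ hl]
    exact and_congr_right fun _ => by grind
  have fibers := card_eq_sum_card_fiberwise (s := {u | P u}) (f := l) (t := univ)
    fun _ _ => mem_univ _
  simp only [filter_filter, translate, sum_const, card_univ, smul_eq_mul] at fibers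
  exact_mod_cast fibers.symm

theorem card_mul_card_fiber {l : Module.Dual k V} (hl : l ≠ 0) (r : k) :
    q * #{u | l u = r} = Fintype.card V := by
  obtain ⟨x, hx⟩ : ∃ x, l x ≠ 0 := by
    by_contra! h
    exact hl (LinearMap.ext h)
  simpa using card_mul_card_fiber_of_invariant (fun _ => True) (by simp) hx r

variable (Q : QuadraticForm k V)

theorem card_mul_sum_sq_card_level (h2 : ringChar k ≠ 2) :
    q * ∑ s, (#{u | Q u = s} : ℚ) ^ 2
      = Fintype.card V ^ 2 + (q - 1) * Fintype.card V * Nat.card Q.polarBilin.ker := by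
  classical
  have increment (a : V) : q * #{u | Q (a + u) = Q u}
      = Fintype.card V + if a ∈ Q.polarBilin.ker then (q - 1) * Fintype.card V else 0 := by
    have h (u : V) : Q (a + u) = Q u ↔ Q.polarBilin a u = -Q a := by
      rw [QuadraticMap.map_add Q, polarBilin_apply_apply]
      grind
    simp only [h]
    split_ifs with ha
    · have hQ : Q a = 0 := map_eq_zero_of_mem_ker_polarBilin h2 ha
      rw [LinearMap.mem_ker] at ha
      simp [ha, hQ]
      ring
    · rw [card_mul_card_fiber ha, add_zero]
  have second_moment := congrArg (Nat.cast : ℕ → ℚ) (sum_sq_card_fiber Q)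
  push_cast at second_moment
  rw [second_moment, mul_sum, sum_congr rfl fun a _ => increment a, sum_add_distrib,
    ← sum_filter, sum_const, sum_const, card_univ, Nat.card_eq_fintype_card,
    Fintype.card_subtype]
  simp only [nsmul_eq_mul]
  ring

variable {Q} in
theorem card_eq_card_level_zero_add {N : ℚ} (hN : ∀ s ≠ 0, (#{u | Q u = s} : ℚ) = N) :
    (Fintype.card V : ℚ) = #{u | Q u = 0} + (q - 1) * N := by
  rw [Fintype.card, card_eq_sum_card_fiberwise (f := Q) (t := univ) fun _ _ => mem_univ _,
    Nat.cast_sum, ← add_sum_erase _ _ (mem_univ 0),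
    sum_congr rfl fun s hs => hN s (ne_of_mem_erase hs), sum_const, nsmul_eq_mul,
    cast_card_erase_of_mem (mem_univ _), card_univ]

variable {Q} in
theorem sq_card_sub_card_mul_card_level (h2 : ringChar k ≠ 2) {N : ℚ}
    (hN : ∀ s ≠ 0, (#{u | Q u = s} : ℚ) = N) :
    (Fintype.card V - q * N) ^ 2 = Fintype.card V * Nat.card Q.polarBilin.ker := by
  have hq : q - 1 ≠ 0 := sub_ne_zero.mpr (by exact_mod_cast Fintype.one_lt_card.ne')
  have total := card_eq_card_level_zero_add hN
  have moment := card_mul_sum_sq_card_level Q h2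
  rw [← add_sum_erase _ _ (mem_univ 0),
    sum_congr rfl fun s hs => by rw [hN s (ne_of_mem_erase hs)], sum_const, nsmul_eq_mul,
    cast_card_erase_of_mem (mem_univ _), card_univ, eq_sub_of_add_eq total.symm] at moment
  exact mul_left_cancel₀ hq (by linear_combination moment)

theorem card_mul_card_level_inter_fiber {x : V} (hx : Q.polarBilin x ≠ 0) (s r : k) :
    q ^ 2 * #{u | Q u = s ∧ polar Q x u = r}
      = q * ∑ t, (#{u | Q u = s + t * r + t ^ 2 * Q x} : ℚ) + Fintype.card V
        - q * Fintype.card V := by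
  have translate : ∑ t, (#{u | Q u = s + t * r + t ^ 2 * Q x} : ℚ)
      = ∑ u, (#{t | Q u + t * polar Q x u = s + t * r} : ℚ) := by
    simp only [natCast_card_filter]
    conv_rhs => rw [sum_comm]
    refine sum_congr rfl fun t _ => ?_
    rw [← Equiv.sum_comp (Equiv.addRight (t • x))]
    simp only [Equiv.coe_addRight, map_add_smul, add_left_inj]
  have line (u : V) : (#{t | Q u + t * polar Q x u = s + t * r} : ℚ)
      = 1 - (if polar Q x u = r then 1 else 0)
        + q * if Q u = s ∧ polar Q x u = r then 1 else 0 := by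
    by_cases hr : polar Q x u = r
    · by_cases hs : Q u = s <;> simp [hr, hs]
    · have h (t : k) : Q u + t * polar Q x u = s + t * r ↔ t = (s - Q u) / (polar Q x u - r) := by
        rw [eq_div_iff (sub_ne_zero.mpr hr)]
        grind
      simp [h, hr, filter_eq']
  have fiber := card_mul_card_fiber hx r
  simp only [polarBilin_apply_apply] at fiber
  rw [translate, sum_congr rfl fun u _ => line u, sum_add_distrib, sum_sub_distrib, ← mul_sum,
    ← natCast_card_filter, ← natCast_card_filter, sum_const, card_univ, nsmul_one]
  linear_combination fiber

/-- The level sets of `Q` have the sizes known for a quadratic form of even rank `2 m` (plus a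
radical): `Z = -ε q ^ (m - 1)` where `ε = ± 1` is the type of the form, hyperbolic or elliptic. -/
def HasEvenRankLevels (Z : ℚ) : Prop :=
  ∀ s, (#{u | Q u = s} : ℚ)
    = Nat.card Q.polarBilin.ker * (q * Z ^ 2 + Z * (1 - if s = 0 then q else 0))

namespace HasEvenRankLevels

variable {Q} {Z : ℚ}

theorem of_ne_zero (hV : (Fintype.card V : ℚ) = Nat.card Q.polarBilin.ker * (q * Z) ^ 2)
    (hN : ∀ s ≠ 0, (#{u | Q u = s} : ℚ) = Nat.card Q.polarBilin.ker * (q * Z ^ 2 + Z)) :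
    HasEvenRankLevels Q Z := by
  intro s
  split_ifs with hs
  · rw [hs]
    linear_combination hV - card_eq_card_level_zero_add hN
  · rw [hN s hs, sub_zero, mul_one]

variable (h : HasEvenRankLevels Q Z)
include h

theorem card_preimage (S : Finset k) :
    (#{u | Q u ∈ S} : ℚ) = Nat.card Q.polarBilin.ker
      * ((q * Z ^ 2 + Z) * #S - q * Z * if 0 ∈ S then 1 else 0) := by
  rw [← sum_card_fiberwise_eq_card_filter, Nat.cast_sum, sum_congr rfl fun s _ => h s, ← mul_sum,
    sum_add_distrib, ← mul_sum, ← mul_sum, sum_sub_distrib, sum_ite_eq' S (0 : k)]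
  simp only [sum_const, nsmul_eq_mul, mul_ite, mul_one, mul_zero]
  split_ifs <;> ring

theorem card_eq : (Fintype.card V : ℚ) = Nat.card Q.polarBilin.ker * (q * Z) ^ 2 := by
  have h_univ := h.card_preimage univ
  simp only [mem_univ, filter_true, card_univ, if_true] at h_univ
  linear_combination h_univ

theorem card_level_inter_fiber {x : V} (hx : Q.polarBilin x ≠ 0) (s r : k) :
    (#{u | Q u = s ∧ polar Q x u = r} : ℚ) = Nat.card Q.polarBilin.ker
      * (Z ^ 2 + Z * (1 - #{t | s + t * r + t ^ 2 * Q x = 0})) := by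
  have hq : q ^ 2 ≠ 0 := pow_ne_zero 2 (Nat.cast_ne_zero.mpr Fintype.card_ne_zero)
  have lines := card_mul_card_level_inter_fiber Q hx s r
  have total : ∑ t, (#{u | Q u = s + t * r + t ^ 2 * Q x} : ℚ) = Nat.card Q.polarBilin.ker
      * (q * (q * Z ^ 2) + Z * (q - q * #{t | s + t * r + t ^ 2 * Q x = 0})) := by
    rw [sum_congr rfl fun t _ => h _, ← mul_sum, sum_add_distrib, ← mul_sum, ← mul_sum,
      sum_sub_distrib, ← sum_filter]
    simp only [sum_const, card_univ, nsmul_eq_mul]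
    ring
  rw [total, h.card_eq] at lines
  exact mul_left_cancel₀ hq (by linear_combination lines)

theorem card_preimage_inter_fiber {x : V} (hx : Q.polarBilin x ≠ 0) (S : Finset k) (r : k) :
    (#{u | Q u ∈ S ∧ polar Q x u = r} : ℚ) = Nat.card Q.polarBilin.ker
      * ((Z ^ 2 + Z) * #S - Z * #{t | -(t * r + t ^ 2 * Q x) ∈ S}) := by
  have root (s t : k) : s + t * r + t ^ 2 * Q x = 0 ↔ -(t * r + t ^ 2 * Q x) = s := by grind
  have levels := congrArg (Nat.cast : ℕ → ℚ)
    (sum_card_fiberwise_eq_card_filter {u | polar Q x u = r} S Q)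
  simp only [filter_filter, and_comm (a := polar Q x _ = r), Nat.cast_sum,
    h.card_level_inter_fiber hx, root] at levels
  rw [← levels, ← sum_card_fiberwise_eq_card_filter, ← mul_sum, sum_add_distrib, ← mul_sum,
    sum_sub_distrib]
  simp only [sum_const, nsmul_eq_mul, Nat.cast_sum]
  ring

end HasEvenRankLevels

/-- The Hamming weight of the word `(l u)_u`, where `u` runs through the translate by `y` of the
preimage of `S` under `Q`. -/
def translateWeight {k V : Type*} [Field k] [DecidableEq k] [AddCommGroup V] [Module k V]
    [Fintype V] (Q : QuadraticForm k V) (S : Finset k) (y : V) (l : Module.Dual k V) : ℕ :=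
  #{u | Q (u - y) ∈ S ∧ l u ≠ 0}

theorem translateWeight_zero {k V : Type*} [Field k] [DecidableEq k] [AddCommGroup V] [Module k V]
    [Fintype V] (Q : QuadraticForm k V) (S : Finset k) (y : V) : translateWeight Q S y 0 = 0 := by
  simp [translateWeight]

theorem translateWeight_eq_sub {k V : Type*} [Field k] [DecidableEq k] [AddCommGroup V]
    [Module k V] [Fintype V] (Q : QuadraticForm k V) (S : Finset k) (y : V)
    (l : Module.Dual k V) :
    (translateWeight Q S y l : ℚ) = #{u | Q u ∈ S} - #{u | Q u ∈ S ∧ l u = -l y} := by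
  have translate : #{u | Q u ∈ S ∧ l u ≠ -l y} = translateWeight Q S y l :=
    card_equiv (Equiv.addRight y) fun u => by simp [add_eq_zero_iff_eq_neg]
  rw [← translate, eq_sub_iff_add_eq']
  simp only [← filter_filter]
  exact_mod_cast card_filter_add_card_filter_not _

variable (S : Finset k) (y : V)

variable {Q} in
theorem card_mul_translateWeight_of_notMem_range (h2 : ringChar k ≠ 2) {l : Module.Dual k V}
    (hl : l ∉ Q.polarBilin.range) :
    q * translateWeight Q S y l = (q - 1) * #{u | Q u ∈ S} := by
  obtain ⟨x, hx, hlx⟩ : ∃ x ∈ Q.polarBilin.ker, l x ≠ 0 := by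
    by_contra! h
    exact hl (range_polarBilin Q ▸ (Submodule.mem_dualAnnihilator l).mpr h)
  have invariant (t : k) (u : V) : Q (u + t • x) ∈ S ↔ Q u ∈ S := by
    have hxu : polar Q x u = 0 := LinearMap.congr_fun hx u
    rw [map_add_smul, hxu, map_eq_zero_of_mem_ker_polarBilin h2 hx, mul_zero, mul_zero, add_zero,
      add_zero]
  rw [translateWeight_eq_sub, mul_sub,
    card_mul_card_fiber_of_invariant (fun u => Q u ∈ S) invariant hlx]
  ring

/-- The weight of the word belonging to `polar Q x`, as a function of the values `v = Q x` and
`t = polar Q x y`, for a form with `HasEvenRankLevels Q Z`. -/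
noncomputable def polarWeight (Z : ℚ) (v t : k) : ℚ :=
  Nat.card Q.polarBilin.ker
    * ((q - 1) * Z ^ 2 * #S + Z * (#{r | r * t - r ^ 2 * v ∈ S} - q * if 0 ∈ S then 1 else 0))

namespace HasEvenRankLevels

variable {Q S y} {Z : ℚ} (h : HasEvenRankLevels Q Z)
include h

theorem translateWeight_polarBilin {x : V} (hx : Q.polarBilin x ≠ 0) :
    translateWeight Q S y (Q.polarBilin x) = polarWeight Q S Z (Q x) (polar Q x y) := by
  have arg (r : k) : -(r * -polar Q x y + r ^ 2 * Q x) = r * polar Q x y - r ^ 2 * Q x := by ring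
  simp only [translateWeight_eq_sub, polarBilin_apply_apply, h.card_preimage,
    h.card_preimage_inter_fiber hx, polarWeight, arg]
  ring

theorem card_level_inter_polar_fiber (h2 : ringChar k ≠ 2) (hy : Q y ≠ 0) (v t : k) :
    (#{x | Q x = v ∧ polar Q x y = t} : ℚ)
      = Nat.card Q.polarBilin.ker * (Z ^ 2 - Z * quadraticChar k (discrim v t (Q y))) := by
  have hy' : Q.polarBilin y ≠ 0 := mt (map_eq_zero_of_mem_ker_polarBilin h2) hy
  have disc : discrim (Q y) t v = discrim v t (Q y) := by simp only [discrim]; ring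
  have roots := congrArg (Int.cast : ℤ → ℚ) (card_roots_quadratic h2 hy t v)
  have comm (r : k) : v + r * t + r ^ 2 * Q y = Q y * r ^ 2 + t * r + v := by ring
  push_cast [disc] at roots
  simp only [polar_comm Q _ y, h.card_level_inter_fiber hy', comm, roots]
  ring

theorem card_dual [Fintype (Module.Dual k V)] :
    (Fintype.card (Module.Dual k V) : ℚ) = Nat.card Q.polarBilin.ker * (q * Z) ^ 2 := by
  rw [← h.card_eq, Module.card_eq_pow_finrank (K := k), Subspace.dual_finrank_eq,
    ← Module.card_eq_pow_finrank]

theorem sum_comp_level_polar (h2 : ringChar k ≠ 2) (hy : Q y ≠ 0) (G : k → k → ℚ) :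
    ∑ x, G (Q x) (polar Q x y) = Nat.card Q.polarBilin.ker
      * ∑ v, ∑ t, (Z ^ 2 - Z * quadraticChar k (discrim v t (Q y))) * G v t := by
  rw [← sum_fiberwise' univ (fun x => (Q x, polar Q x y)) fun p => G p.1 p.2,
    Fintype.sum_prod_type]
  simp only [Prod.mk.injEq, sum_const, nsmul_eq_mul, h.card_level_inter_polar_fiber h2 hy,
    mul_sum, mul_assoc]

variable [Fintype (Module.Dual k V)]

open Classical in
theorem card_range_polarBilin :
    (#{l | l ∈ Q.polarBilin.range} : ℚ) = (q * Z) ^ 2 := by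
  have hρ : (Nat.card Q.polarBilin.ker : ℚ) ≠ 0 := Nat.cast_ne_zero.mpr Nat.card_pos.ne'
  have total := sum_comp_linearMap Q.polarBilin fun _ => (1 : ℚ)
  simp only [sum_const, nsmul_one, card_univ, h.card_eq] at total
  exact mul_left_cancel₀ hρ total.symm

open Classical in
theorem sum_range_comp_translateWeight (h2 : ringChar k ≠ 2) (hy : Q y ≠ 0) (g : ℚ → ℚ) :
    ∑ l with l ∈ Q.polarBilin.range, g (translateWeight Q S y l)
      = g 0 - g (polarWeight Q S Z 0 0)
        + ∑ v, ∑ t, (Z ^ 2 - Z * quadraticChar k (discrim v t (Q y)))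
            * g (polarWeight Q S Z v t) := by
  have hρ : (Nat.card Q.polarBilin.ker : ℚ) ≠ 0 := Nat.cast_ne_zero.mpr Nat.card_pos.ne'
  have term (x : V) : g (translateWeight Q S y (Q.polarBilin x))
      = g (polarWeight Q S Z (Q x) (polar Q x y))
        + if x ∈ Q.polarBilin.ker then g 0 - g (polarWeight Q S Z 0 0) else 0 := by
    split_ifs with hx
    · have hQ : Q x = 0 := map_eq_zero_of_mem_ker_polarBilin h2 hx
      have hpolar : polar Q x y = 0 := LinearMap.congr_fun hx y
      rw [LinearMap.mem_ker.mp hx, translateWeight_zero, hQ, hpolar, Nat.cast_zero]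
      ring
    · rw [h.translateWeight_polarBilin hx, add_zero]
  have ker_card : #{x | x ∈ Q.polarBilin.ker} = Nat.card Q.polarBilin.ker := by
    rw [Nat.card_eq_fintype_card, Fintype.card_subtype]
  have fibers := sum_comp_linearMap Q.polarBilin fun l => g (translateWeight Q S y l)
  rw [sum_congr rfl fun x _ => term x, sum_add_distrib, ← sum_filter, sum_const, ker_card,
    nsmul_eq_mul, h.sum_comp_level_polar h2 hy fun v t => g (polarWeight Q S Z v t)] at fibers
  exact mul_left_cancel₀ hρ (by linear_combination -fibers)

theorem sum_comp_translateWeight (h2 : ringChar k ≠ 2) (hy : Q y ≠ 0) (g : ℚ → ℚ) :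
    ∑ l, g (translateWeight Q S y l)
      = g 0 + (q * Z) ^ 2 * (Nat.card Q.polarBilin.ker - 1) * g ((q - 1) / q * #{u | Q u ∈ S})
        - g (polarWeight Q S Z 0 0)
        + ∑ v, ∑ t, (Z ^ 2 - Z * quadraticChar k (discrim v t (Q y)))
            * g (polarWeight Q S Z v t) := by
  classical
  have hq : q ≠ 0 := Nat.cast_ne_zero.mpr Fintype.card_ne_zero
  have outside (l : Module.Dual k V) (hl : l ∈ ({l | l ∉ Q.polarBilin.range} : Finset _)) :
      g (translateWeight Q S y l) = g ((q - 1) / q * #{u | Q u ∈ S}) := by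
    have weight := card_mul_translateWeight_of_notMem_range S y h2 (mem_filter.mp hl).2
    congr 1
    field_simp
    linear_combination weight
  have outside_card := congrArg (Nat.cast : ℕ → ℚ)
    (card_filter_add_card_filter_not (s := univ) fun l => l ∈ Q.polarBilin.range)
  push_cast [card_univ, h.card_dual, h.card_range_polarBilin] at outside_card
  rw [← sum_filter_add_sum_filter_not univ fun l => l ∈ Q.polarBilin.range,
    h.sum_range_comp_translateWeight h2 hy, sum_congr rfl outside, sum_const, nsmul_eq_mul]
  linear_combination g ((q - 1) / q * #{u | Q u ∈ S}) * outside_card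

end HasEvenRankLevels

section OppositeClass

local notation "η" => quadraticChar k
local notation "ρ" => (Nat.card Q.polarBilin.ker : ℚ)

/-- The weight `polarWeight Q (oppositeClass c) Z v t` in terms of
`R = #{r | r * t - r ^ 2 * v ∈ oppositeClass c}`. -/
noncomputable def oppositeClassWeight (Z R : ℚ) : ℚ :=
  ρ * ((q - 1) ^ 2 / 2 * Z ^ 2 + Z * (R - q * (1 - η (-1)) / 2))

/-- The weights, with multiplicities, of the words indexed by the dual space in the case
`S = oppositeClass (Q y)`, for a form with `HasEvenRankLevels Q Z`. Rows are (weight, multiplicity),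
as in `tableMultiplicity`. -/
noncomputable def oppositeClassTable (Z : ℚ) : List (ℚ × ℚ) :=
  [ (0, 1),
    ((q - 1) / q * (ρ * ((q * Z ^ 2 + Z) * ((q - 1) / 2) - q * Z * ((1 - η (-1)) / 2))),
      (q * Z) ^ 2 * (ρ - 1)),
    (oppositeClassWeight Q Z (q * (1 - η (-1)) / 2), Z ^ 2 - 1),
    (oppositeClassWeight Q Z ((q - 1) / 2), (q - 1) * (Z ^ 2 - Z)),
    (oppositeClassWeight Q Z ((q - 1) * (1 - η (-1)) / 2), (q - 1) * Z ^ 2),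
    (oppositeClassWeight Q Z ((q - 2 + η (-1)) / 2), (q - 1) * (q - 3) / 4 * (Z ^ 2 - Z)),
    (oppositeClassWeight Q Z ((q + η (-1)) / 2), (q - 1) ^ 2 / 4 * (Z ^ 2 + Z)),
    (oppositeClassWeight Q Z ((q - 2 - η (-1)) / 2), (q - 1) ^ 2 / 4 * (Z ^ 2 - Z)),
    (oppositeClassWeight Q Z ((q - η (-1)) / 2), (q ^ 2 - 1) / 4 * (Z ^ 2 + Z)) ]

variable (Z : ℚ) {c : k} (hc : c ≠ 0) (h2 : ringChar k ≠ 2)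
include hc h2
omit [Fintype V]

theorem polarWeight_oppositeClass (v t : k) :
    polarWeight Q (oppositeClass c) Z v t
      = oppositeClassWeight Q Z #{r | r * t - r ^ 2 * v ∈ oppositeClass c} := by
  rw [polarWeight, oppositeClassWeight, card_oppositeClass hc h2, ite_zero_mem_oppositeClass hc]
  ring

theorem polarWeight_oppositeClass_zero_zero :
    polarWeight Q (oppositeClass c) Z 0 0 = oppositeClassWeight Q Z (q * (1 - η (-1)) / 2) := by
  rw [polarWeight_oppositeClass Q Z hc h2, mul_div_assoc, ← ite_zero_mem_oppositeClass hc]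
  by_cases h0 : 0 ∈ oppositeClass c <;> simp [h0]

theorem polarWeight_oppositeClass_zero {t : k} (ht : t ≠ 0) :
    polarWeight Q (oppositeClass c) Z 0 t = oppositeClassWeight Q Z ((q - 1) / 2) := by
  have line : #{r | r * t - r ^ 2 * 0 ∈ oppositeClass c} = #(oppositeClass c) :=
    card_bijective _ (mulRight_bijective₀ t ht) (by simp)
  rw [polarWeight_oppositeClass Q Z hc h2, line, card_oppositeClass hc h2]

theorem polarWeight_oppositeClass_of_ne_zero {v : k} (hv : v ≠ 0) (t : k) :
    polarWeight Q (oppositeClass c) Z v t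
      = oppositeClassWeight Q Z
          ((q - 1 - η (discrim v t c)
            - η (-1) * η (v * c) * if η (discrim v t c) = 0 then q - 1 else -1) / 2) := by
  rw [polarWeight_oppositeClass Q Z hc h2, ← two_mul_card_quadratic_mem_oppositeClass hc h2 hv,
    mul_div_cancel_left₀ _ two_ne_zero]

theorem sum_discrim_zero_mul_polarWeight (g : ℚ → ℚ) :
    ∑ t, (Z ^ 2 - Z * η (discrim 0 t c)) * g (polarWeight Q (oppositeClass c) Z 0 t)
      = Z ^ 2 * g (polarWeight Q (oppositeClass c) Z 0 0)
        + (q - 1) * (Z ^ 2 - Z) * g (oppositeClassWeight Q Z ((q - 1) / 2)) := by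
  have disc (t : k) : discrim 0 t c = t ^ 2 := by simp [discrim]
  have off_zero (t : k) (ht : t ∈ univ.erase 0) :
      (Z ^ 2 - Z * η (discrim 0 t c)) * g (polarWeight Q (oppositeClass c) Z 0 t)
        = (Z ^ 2 - Z) * g (oppositeClassWeight Q Z ((q - 1) / 2)) := by
    rw [polarWeight_oppositeClass_zero Q Z hc h2 (ne_of_mem_erase ht), disc,
      quadraticChar_sq_one' (ne_of_mem_erase ht), Int.cast_one, mul_one]
  rw [← add_sum_erase _ _ (mem_univ 0), sum_congr rfl off_zero, sum_const, nsmul_eq_mul,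
    cast_card_erase_of_mem (mem_univ _), card_univ, disc, zero_pow two_ne_zero,
    quadraticChar_zero]
  push_cast
  ring

theorem sum_erase_discrim_mul_polarWeight (g : ℚ → ℚ) :
    ∑ v ∈ univ.erase 0, ∑ t,
        (Z ^ 2 - Z * η (discrim v t c)) * g (polarWeight Q (oppositeClass c) Z v t)
      = (((oppositeClassTable Q Z).drop 4).map fun r => r.2 * g r.1).sum := by
  rw [sum_congr rfl fun v hv => sum_congr rfl fun t _ => by
    rw [polarWeight_oppositeClass_of_ne_zero Q Z hc h2 (ne_of_mem_erase hv)],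
    sum_comp_quadraticChar_discrim h2 hc fun α β => (Z ^ 2 - Z * β)
      * g (oppositeClassWeight Q Z
          ((q - 1 - β - η (-1) * α * if β = 0 then q - 1 else -1) / 2))]
  simp only [oppositeClassTable, List.drop_succ_cons, List.drop_zero, List.map_cons, List.map_nil,
    List.sum_cons, List.sum_nil]
  norm_num
  ring_nf

end OppositeClass

namespace HasEvenRankLevels

variable {Q} {Z : ℚ} (h : HasEvenRankLevels Q Z) (h2 : ringChar k ≠ 2)
include h h2

theorem card_preimage_oppositeClass {c : k} (hc : c ≠ 0) :
    (#{u | Q u ∈ oppositeClass c} : ℚ) = Nat.card Q.polarBilin.ker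
      * ((q * Z ^ 2 + Z) * ((q - 1) / 2) - q * Z * ((1 - quadraticChar k (-1)) / 2)) := by
  rw [h.card_preimage, card_oppositeClass hc h2, ite_zero_mem_oppositeClass hc]

theorem sum_comp_translateWeight_oppositeClass {y : V} (hy : Q y ≠ 0)
    [Fintype (Module.Dual k V)] (g : ℚ → ℚ) :
    ∑ l, g (translateWeight Q (oppositeClass (Q y)) y l)
      = ((oppositeClassTable Q Z).map fun r => r.2 * g r.1).sum := by
  rw [h.sum_comp_translateWeight h2 hy, h.card_preimage_oppositeClass h2 hy,
    ← add_sum_erase _ _ (mem_univ 0), sum_discrim_zero_mul_polarWeight Q Z hy h2,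
    sum_erase_discrim_mul_polarWeight Q Z hy h2, polarWeight_oppositeClass_zero_zero Q Z hy h2]
  simp only [oppositeClassTable, List.drop_succ_cons, List.drop_zero, List.map_cons, List.sum_cons]
  ring

end HasEvenRankLevels

end LevelSets

section PowersInFiniteFields

open Finset

variable {F : Type*} [Field F] [Fintype F]

theorem exists_isPrimitiveRoot_card_sub_one : ∃ ζ : F, IsPrimitiveRoot ζ (Fintype.card F - 1) := by
  obtain ⟨g, hg⟩ := IsCyclic.exists_ofOrder_eq_natCard (α := Fˣ)
  rw [Nat.card_units, Nat.card_eq_fintype_card] at hg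
  exact ⟨g, IsPrimitiveRoot.coe_units_iff.mpr (hg ▸ IsPrimitiveRoot.orderOf g)⟩

theorem exists_pow_eq_of_pow_eq_one {d m : ℕ} (hdm : Fintype.card F - 1 = d * m) {x : F}
    (hx : x ^ m = 1) : ∃ y : F, y ^ d = x := by
  have hpos : 0 < Fintype.card F - 1 := Nat.sub_pos_of_lt Fintype.one_lt_card
  have : NeZero m := ⟨by rintro rfl; simp_all⟩
  obtain ⟨ζ, hζ⟩ := exists_isPrimitiveRoot_card_sub_one (F := F)
  obtain ⟨i, -, hi⟩ := (hζ.pow hpos hdm).eq_pow_of_pow_eq_one hx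
  exact ⟨ζ ^ i, by rw [← hi, pow_right_comm]⟩

theorem card_pow_eq_pow [DecidableEq F] {d : ℕ} (hd : d ∣ Fintype.card F - 1) {x : F}
    (hx : x ≠ 0) : #{u | u ^ d = x ^ d} = d := by
  have hpos : 0 < Fintype.card F - 1 := Nat.sub_pos_of_lt Fintype.one_lt_card
  obtain ⟨m, hm⟩ := hd
  obtain ⟨ζ, hζ⟩ := exists_isPrimitiveRoot_card_sub_one (F := F)
  have hζ := hζ.pow hpos (hm.trans (mul_comm d m))
  have roots : ({u | u ^ d = x ^ d} : Finset F) = (Polynomial.nthRoots d (x ^ d)).toFinset := by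
    ext u
    simp [Polynomial.mem_nthRoots (Nat.pos_of_dvd_of_pos ⟨m, hm⟩ hpos)]
  rw [roots, Multiset.toFinset_card_of_nodup (hζ.nthRoots_nodup (pow_ne_zero d hx)),
    hζ.card_nthRoots, if_pos ⟨x, rfl⟩]

theorem dvd_card_filter_pow {d : ℕ} (hd : d ∣ Fintype.card F - 1) (P : F → Prop)
    [DecidablePred P] (hP : ¬P 0) : d ∣ #{u : F | P (u ^ d)} := by
  classical
  have hpos : 0 < Fintype.card F - 1 := Nat.sub_pos_of_lt Fintype.one_lt_card
  have zero_pow_d : (0 : F) ^ d = 0 := zero_pow (Nat.pos_of_dvd_of_pos hd hpos).ne'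
  rw [card_eq_sum_card_image fun u : F => u ^ d]
  refine dvd_sum fun b hb => ?_
  obtain ⟨x, hx, rfl⟩ := mem_image.mp hb
  have hPx : P (x ^ d) := (mem_filter.mp hx).2
  have hx0 : x ≠ 0 := by
    rintro rfl
    exact hP (zero_pow_d ▸ hPx)
  have fiber (u : F) : P (u ^ d) ∧ u ^ d = x ^ d ↔ u ^ d = x ^ d :=
    and_iff_right_of_imp fun h => h ▸ hPx
  simp only [filter_filter, fiber, card_pow_eq_pow hd hx0, dvd_refl]

end PowersInFiniteFields

section NormTraceForm

open Finset

variable (k F : Type*) [Field k] [Fintype k] [Field F] [Algebra k F]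

local notation "q" => Fintype.card k

/-- The quadratic form `x ↦ Tr (x ^ (q + 1))` on an extension of the field `k` of order `q`. -/
noncomputable def normTraceForm : QuadraticForm k F :=
  LinearMap.BilinMap.toQuadraticMap ((Algebra.traceForm k F).compl₁₂
    (FiniteField.frobeniusAlgHom k F).toLinearMap LinearMap.id)

theorem normTraceForm_apply (x : F) : normTraceForm k F x = Algebra.trace k F (x ^ (q + 1)) := by
  simp [normTraceForm, pow_succ]

theorem polar_normTraceForm (x y : F) :
    QuadraticMap.polar (normTraceForm k F) x y
      = Algebra.trace k F (x ^ q * y) + Algebra.trace k F (y ^ q * x) := by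
  simp [normTraceForm, LinearMap.BilinMap.polar_toQuadraticMap]

variable {k} in
theorem normTraceForm_mul {w : F} {a : k} (hw : w ^ (q + 1) = algebraMap k F a) (x : F) :
    normTraceForm k F (w * x) = a * normTraceForm k F x := by
  rw [normTraceForm_apply, normTraceForm_apply, mul_pow, hw, ← Algebra.smul_def, map_smul,
    smul_eq_mul]

section Divisibility

variable [Fintype F] {n : ℕ} (hn : Module.finrank k F = 4 * (n + 1))
include hn

theorem sq_card_sub_one_mul_two_dvd (h2 : ringChar k ≠ 2) :
    (q ^ 2 - 1) * 2 ∣ Fintype.card F - 1 := by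
  rw [Module.card_eq_pow_finrank (K := k) (V := F), hn]
  have odd_q : Odd q := Nat.odd_iff.mpr (FiniteField.odd_card_of_char_ne_two h2)
  calc (q ^ 2 - 1) * 2 ∣ (q ^ 2 - 1) * (q ^ 2 + 1) :=
        mul_dvd_mul_left _ odd_q.pow.add_one.two_dvd
    _ = q ^ 4 - 1 := by rw [mul_comm, ← Nat.sq_sub_sq (q ^ 2) 1, ← pow_mul, one_pow]
    _ ∣ q ^ (4 * (n + 1)) - 1 := Nat.pow_sub_one_dvd_pow_sub_one q (Dvd.intro _ rfl)

theorem card_add_one_mul_card_sub_one_dvd : (q + 1) * (q - 1) ∣ Fintype.card F - 1 := by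
  rw [Module.card_eq_pow_finrank (K := k) (V := F), hn, ← Nat.sq_sub_sq, one_pow]
  exact Nat.pow_sub_one_dvd_pow_sub_one q ⟨2 * (n + 1), by ring⟩

end Divisibility

section FiniteExtension

variable [Finite F]

theorem trace_pow_card (x : F) : Algebra.trace k F (x ^ q) = Algebra.trace k F x :=
  Algebra.trace_eq_of_algEquiv (FiniteField.frobeniusAlgEquivOfAlgebraic k F) x

theorem pow_card_surjective : Function.Surjective fun x : F => x ^ q :=
  (FiniteField.frobeniusAlgEquivOfAlgebraic k F).surjective

theorem polarBilin_normTraceForm (y x : F) :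
    (normTraceForm k F).polarBilin y x = Algebra.trace k F ((y ^ q ^ 2 + y) * x ^ q) := by
  rw [QuadraticMap.polarBilin_apply_apply, polar_normTraceForm, ← trace_pow_card k F (y ^ q * x),
    ← map_add]
  congr 1
  ring

theorem mem_ker_polarBilin_normTraceForm {y : F} :
    y ∈ (normTraceForm k F).polarBilin.ker ↔ y ^ q ^ 2 = -y := by
  rw [LinearMap.mem_ker, ← add_eq_zero_iff_eq_neg]
  constructor
  · intro hy
    refine (traceForm_nondegenerate k F).1 _ fun w => ?_
    obtain ⟨u, rfl⟩ := pow_card_surjective k F w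
    rw [Algebra.traceForm_apply, ← polarBilin_normTraceForm, hy, LinearMap.zero_apply]
  · intro hy
    ext u
    rw [polarBilin_normTraceForm, hy, zero_mul, map_zero, LinearMap.zero_apply]

variable {n : ℕ} (hn : Module.finrank k F = 4 * (n + 1))
include hn

theorem card_ker_polarBilin_normTraceForm (h2 : ringChar k ≠ 2) :
    Nat.card (normTraceForm k F).polarBilin.ker = q ^ 2 := by
  classical
  have := Fintype.ofFinite F
  have hq : 1 < q ^ 2 := Nat.one_lt_pow two_ne_zero Fintype.one_lt_card
  obtain ⟨j, hj⟩ := sq_card_sub_one_mul_two_dvd k F hn h2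
  rw [mul_assoc] at hj
  obtain ⟨y, hy⟩ := exists_pow_eq_of_pow_eq_one hj (x := (-1 : F)) (by simp)
  have hy0 : y ≠ 0 := by
    rintro rfl
    simp [zero_pow (Nat.sub_pos_of_lt hq).ne'] at hy
  have ker_eq : filter (· ∈ (normTraceForm k F).polarBilin.ker) univ
      = insert 0 (filter (fun u : F => u ^ (q ^ 2 - 1) = y ^ (q ^ 2 - 1)) univ) := by
    ext u
    simp only [mem_filter_univ, mem_insert, mem_ker_polarBilin_normTraceForm, hy]
    rcases eq_or_ne u 0 with rfl | hu
    · simp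
    · rw [or_iff_right hu, ← pow_sub_one_mul hq.ne_bot, ← neg_one_mul u, mul_left_inj' hu]
  rw [Nat.card_eq_fintype_card, Fintype.card_subtype, ker_eq, card_insert_of_notMem,
    card_pow_eq_pow (Dvd.intro _ hj.symm) hy0, Nat.sub_add_cancel hq.le]
  simp [hy, (Nat.sub_pos_of_lt hq).ne']

theorem exists_pow_card_add_one_eq_algebraMap {a : k} (ha : a ≠ 0) :
    ∃ w : F, w ^ (q + 1) = algebraMap k F a := by
  have := Fintype.ofFinite F
  obtain ⟨j, hj⟩ := card_add_one_mul_card_sub_one_dvd k F hn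
  refine exists_pow_eq_of_pow_eq_one (hj.trans (mul_assoc ..)) ?_
  rw [pow_mul, ← map_pow, FiniteField.pow_card_sub_one_eq_one a ha, map_one, one_pow]

end FiniteExtension

section Levels

variable [Fintype F] {n : ℕ} (hn : Module.finrank k F = 4 * (n + 1))
include hn

variable [DecidableEq k]

theorem card_level_normTraceForm_mul {a : k} (ha : a ≠ 0) (s : k) :
    #{u | normTraceForm k F u = a * s} = #{u | normTraceForm k F u = s} := by
  obtain ⟨w, hw⟩ := exists_pow_card_add_one_eq_algebraMap k F hn ha
  have hw0 : w ≠ 0 := by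
    rintro rfl
    exact ha (by simpa using hw.symm)
  refine (card_bijective (w * ·) (mulLeft_bijective₀ w hw0) fun u => ?_).symm
  simp [normTraceForm_mul F hw, ha]

theorem card_add_one_dvd_card_level_one : q + 1 ∣ #{u | normTraceForm k F u = 1} := by
  simp only [normTraceForm_apply]
  refine dvd_card_filter_pow ((Dvd.intro _ rfl).trans (card_add_one_mul_card_sub_one_dvd k F hn))
    (fun x => Algebra.trace k F x = 1) (by simp)

theorem card_mul_card_level_one_normTraceForm (h2 : ringChar k ≠ 2) :
    (q * #{u | normTraceForm k F u = 1} : ℤ) = q ^ (4 * (n + 1)) + q ^ (2 * (n + 1) + 1) := by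
  set N := #{u | normTraceForm k F u = 1}
  have sq_eq : ((q : ℤ) ^ (4 * (n + 1)) - q * N) ^ 2 = (q ^ (2 * (n + 1) + 1)) ^ 2 := by
    have level (s : k) (hs : s ≠ 0) : (#{u | normTraceForm k F u = s} : ℚ) = N := by
      simpa using card_level_normTraceForm_mul k F hn hs 1
    have moment := sq_card_sub_card_mul_card_level h2 level
    rw [card_ker_polarBilin_normTraceForm k F hn h2,
      Module.card_eq_pow_finrank (K := k) (V := F), hn] at moment
    push_cast at moment
    rw [← Int.cast_inj (α := ℚ)]
    push_cast
    rw [moment]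
    ring
  rcases sq_eq_sq_iff_eq_or_eq_neg.mp sq_eq with h | h
  · -- modulo `q + 1` this says `1 ≡ -1`
    exfalso
    have q_mod : (q : ℤ) ≡ -1 [ZMOD q + 1] := (Int.modEq_iff_dvd.mpr ⟨1, by ring⟩).symm
    have N_mod : (N : ℤ) ≡ 0 [ZMOD q + 1] := (Int.modEq_zero_iff_dvd.mpr
      (by exact_mod_cast card_add_one_dvd_card_level_one k F hn))
    have one_mod : (1 : ℤ) ≡ -1 [ZMOD q + 1] := by
      have left := ((q_mod.pow (4 * (n + 1))).sub (q_mod.mul N_mod))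
      have right := q_mod.pow (2 * (n + 1) + 1)
      rw [h] at left
      simpa [pow_succ, pow_mul] using left.symm.trans right
    have := Int.le_of_dvd two_pos (by simpa using one_mod.symm.dvd)
    have := FiniteField.odd_card_of_char_ne_two h2
    have := Fintype.one_lt_card (α := k)
    grind
  · linear_combination -h

theorem hasEvenRankLevels_normTraceForm (h2 : ringChar k ≠ 2) :
    HasEvenRankLevels (normTraceForm k F) ((q : ℚ) ^ (2 * n)) := by
  refine .of_ne_zero ?_ fun s hs => ?_
  · rw [card_ker_polarBilin_normTraceForm k F hn h2,
      Module.card_eq_pow_finrank (K := k) (V := F), hn]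
    push_cast
    ring
  · have level_one : (q * #{u | normTraceForm k F u = 1} : ℚ)
        = q ^ (4 * (n + 1)) + q ^ (2 * (n + 1) + 1) := by
      exact_mod_cast card_mul_card_level_one_normTraceForm k F hn h2
    have hq : (q : ℚ) ≠ 0 := Nat.cast_ne_zero.mpr Fintype.card_ne_zero
    have level : #{u | normTraceForm k F u = s} = #{u | normTraceForm k F u = 1} := by
      simpa using card_level_normTraceForm_mul k F hn hs 1
    rw [card_ker_polarBilin_normTraceForm k F hn h2, level]
    refine mul_left_cancel₀ hq (level_one.trans ?_)
    push_cast
    ring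

end Levels

end NormTraceForm

section DefiningSet

open Finset

variable (k F : Type*) [Field k] [Fintype k] [Field F] [Algebra k F]

theorem polar_normTraceForm_half [Finite F] (h2 : ringChar k ≠ 2) (x : F) :
    QuadraticMap.polar (normTraceForm k F) (algebraMap k F 2⁻¹) x = Algebra.trace k F x := by
  rw [polar_normTraceForm, ← map_pow, FiniteField.pow_card, mul_comm (x ^ _), ← Algebra.smul_def,
    ← Algebra.smul_def, map_smul, map_smul, trace_pow_card, ← add_smul, ← two_mul,
    mul_inv_cancel₀ (Ring.two_ne_zero h2), one_smul]

theorem normTraceForm_half :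
    normTraceForm k F (algebraMap k F 2⁻¹) = Module.finrank k F * 2⁻¹ ^ 2 := by
  rw [normTraceForm_apply, ← map_pow, Algebra.trace_algebraMap, pow_succ, FiniteField.pow_card, sq,
    nsmul_eq_mul]

theorem normTraceForm_half_ne_zero (h2 : ringChar k ≠ 2) (hF : (Module.finrank k F : k) ≠ 0) :
    normTraceForm k F (algebraMap k F 2⁻¹) ≠ 0 := by
  rw [normTraceForm_half]
  exact mul_ne_zero hF (pow_ne_zero 2 (inv_ne_zero (Ring.two_ne_zero h2)))

variable [DecidableEq k] [Fintype F]

/-- The elements `x` such that `Tr (x ^ (q + 1) - x)` and the degree `[F : k]` have opposite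
quadratic characters in `k`, where `q` is the order of `k`. It is the set `definingSet p F i` when
`k = ZMod p` and the degree has quadratic character `(-1) ^ (1 - i)`. -/
noncomputable def normTraceSet : Finset F :=
  {x | quadraticChar k (Algebra.trace k F (x ^ (Fintype.card k + 1) - x))
    = -quadraticChar k (Module.finrank k F)}

theorem mem_normTraceSet (h2 : ringChar k ≠ 2) {x : F} :
    x ∈ normTraceSet k F ↔ normTraceForm k F (x - algebraMap k F 2⁻¹)
      ∈ oppositeClass (normTraceForm k F (algebraMap k F 2⁻¹)) := by
  have translate : Algebra.trace k F (x ^ (Fintype.card k + 1) - x)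
      = normTraceForm k F (x - algebraMap k F 2⁻¹) - normTraceForm k F (algebraMap k F 2⁻¹) := by
    have h := map_add_smul (normTraceForm k F) x (algebraMap k F 2⁻¹) (-1)
    rw [neg_one_smul, ← sub_eq_add_neg, polar_normTraceForm_half k F h2,
      normTraceForm_apply k F x] at h
    rw [map_sub, h]
    ring
  have half : quadraticChar k (normTraceForm k F (algebraMap k F 2⁻¹))
      = quadraticChar k (Module.finrank k F) := by
    rw [normTraceForm_half, map_mul, quadraticChar_sq_one' (inv_ne_zero (Ring.two_ne_zero h2)),
      mul_one]
  rw [normTraceSet, mem_filter_univ, translate, mem_oppositeClass, half]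

theorem card_normTraceSet (h2 : ringChar k ≠ 2) :
    #(normTraceSet k F) = #{u | normTraceForm k F u
      ∈ oppositeClass (normTraceForm k F (algebraMap k F 2⁻¹))} :=
  card_equiv (Equiv.subRight (algebraMap k F 2⁻¹)) fun x => by simp [mem_normTraceSet k F h2]

end DefiningSet

section TraceCodes

open Finset

/-- The linear map `a ↦ (Tr (a x))_{x ∈ D}` over an arbitrary base field; `codeword p` is the case
`k = ZMod p`. -/
noncomputable def traceWord (k : Type*) {F : Type*} [Field k] [Field F] [Algebra k F]
    (D : Finset F) : F →ₗ[k] (D → k) :=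
  LinearMap.pi fun x : D => (Algebra.trace k F).comp (LinearMap.mulRight k (x : F))

/-- The number of words of Hamming weight `w` in a linear code over an arbitrary field;
`weightCount` is the case `k = ZMod p`. -/
noncomputable def wordCount {k ι : Type*} [Field k] [DecidableEq k] [Fintype ι]
    (C : Submodule k (ι → k)) (w : ℕ) : ℕ :=
  Set.ncard {c : ι → k | c ∈ C ∧ hammingNorm c = w}

variable {k : Type*} [Field k] [DecidableEq k]

theorem hammingNorm_traceWord {F : Type*} [Field F] [Algebra k F] (D : Finset F) (a : F) :
    hammingNorm (traceWord k D a) = #{x ∈ D | Algebra.trace k F (a * x) ≠ 0} :=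
  card_nbij Subtype.val (fun x hx => mem_filter.mpr ⟨x.2, (mem_filter_univ x).mp hx⟩)
    Subtype.val_injective.injOn fun x hx => by
      obtain ⟨hxD, hx⟩ := mem_filter.mp hx
      exact ⟨⟨x, hxD⟩, (mem_filter_univ _).mpr hx, rfl⟩

variable {V ι : Type*} [AddCommGroup V] [Module k V] [Fintype V] [Fintype ι] (f : V →ₗ[k] (ι → k))

theorem card_ker_mul_wordCount_range [Finite k] (w : ℕ) :
    (Nat.card f.ker * wordCount f.range w : ℚ) = #{a | hammingNorm (f a) = w} := by
  classical
  have := Fintype.ofFinite k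
  have h := sum_comp_linearMap f fun c => if hammingNorm c = w then 1 else 0
  rw [← natCast_card_filter, ← natCast_card_filter, filter_filter] at h
  rw [h, wordCount, ← Set.ncard_coe_finset, coe_filter_univ]

theorem card_ker_eq_card_hammingNorm_eq_zero :
    Nat.card f.ker = #{a | hammingNorm (f a) = 0} := by
  classical
  simp only [hammingNorm_eq_zero, ← LinearMap.mem_ker]
  rw [Nat.card_eq_fintype_card, Fintype.card_subtype]

end TraceCodes

section TraceCodeWeights

open Finset

variable (k F : Type*) [Field k] [Fintype k] [DecidableEq k] [Field F] [Fintype F] [Algebra k F]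

theorem hammingNorm_traceWord_normTraceSet (h2 : ringChar k ≠ 2) (a : F) :
    hammingNorm (traceWord k (normTraceSet k F) a)
      = translateWeight (normTraceForm k F)
          (oppositeClass (normTraceForm k F (algebraMap k F 2⁻¹))) (algebraMap k F 2⁻¹)
          (Algebra.traceForm k F a) := by
  rw [hammingNorm_traceWord, translateWeight]
  congr 1
  ext x
  simp [mem_normTraceSet k F h2, Algebra.traceForm_apply]

end TraceCodeWeights

section WeightTables

/-- The weight table of the code for `q ≡ 1, 3 (mod 4)`. -/
def weightTable (q e : ℕ) : List (ℚ × ℚ) :=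
  if q % 4 = 1 then weightTableOne q e else weightTableThree q e

theorem encard_tableMultiplicity_ne_zero_le (m : ℚ) (T : List (ℚ × ℚ)) :
    {w : ℕ | w ≠ 0 ∧ tableMultiplicity ((0, m) :: T) w ≠ 0}.encard ≤ T.length := by
  classical
  have mem_weights : (Nat.cast : ℕ → ℚ) '' {w | w ≠ 0 ∧ tableMultiplicity ((0, m) :: T) w ≠ 0}
      ⊆ ((T.map Prod.fst).toFinset : Set ℚ) := by
    rintro _ ⟨w, ⟨hw0, hw⟩, rfl⟩
    obtain ⟨x, hx, hx0⟩ := List.exists_mem_ne_zero_of_sum_ne_zero hw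
    obtain ⟨r, hr, rfl⟩ := List.mem_map.mp hx
    have hrw : r.1 = w := by_contra fun h => hx0 (if_neg h)
    rcases List.mem_cons.mp hr with rfl | hr
    · exact absurd hrw.symm (Nat.cast_ne_zero.mpr hw0)
    · simpa using ⟨r.2, hrw ▸ hr⟩
  calc {w : ℕ | w ≠ 0 ∧ tableMultiplicity ((0, m) :: T) w ≠ 0}.encard
      ≤ ((T.map Prod.fst).toFinset : Set ℚ).encard := by
        rw [← (Nat.cast_injective (R := ℚ)).encard_image]
        exact Set.encard_le_encard mem_weights
    _ ≤ T.length := by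
        rw [Set.encard_coe_eq_coe_finsetCard, ← List.length_map (f := Prod.fst) (as := T)]
        exact Nat.cast_le.mpr (List.toFinset_card_le _)

theorem encard_weightTable_ne_zero_le (q e : ℕ) :
    {w : ℕ | w ≠ 0 ∧ tableMultiplicity (weightTable q e) w ≠ 0}.encard ≤ 6 := by
  rw [weightTable]
  split_ifs
  · exact (encard_tableMultiplicity_ne_zero_le 1 (weightTableOne q e).tail).trans
      (by norm_num [weightTableOne])
  · exact (encard_tableMultiplicity_ne_zero_le 1 (weightTableThree q e).tail).trans
      (by norm_num [weightTableThree])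

theorem tableMultiplicity_zero {T : List (ℚ × ℚ)} (hT : ∀ r ∈ T, 0 < r.1) (m : ℚ) :
    tableMultiplicity ((0, m) :: T) 0 = m := by
  rw [tableMultiplicity, List.map_cons, List.sum_cons, if_pos Nat.cast_zero.symm,
    List.sum_eq_zero, add_zero]
  simp only [List.forall_mem_map]
  exact fun r hr => if_neg (Nat.cast_zero (R := ℚ) ▸ (hT r hr).ne')

theorem tableMultiplicity_weightTableOne_zero {q : ℕ} (hq : 3 ≤ q) (e : ℕ) :
    tableMultiplicity (weightTableOne q e) 0 = 1 := by
  have h3 : (0 : ℚ) ≤ q - 3 := sub_nonneg.mpr (by exact_mod_cast hq)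
  have h1 : (0 : ℚ) < q - 1 := by linarith
  have : (0 : ℚ) < q := by linarith
  refine tableMultiplicity_zero (fun r hr => ?_) 1
  simp only [List.mem_cons, List.not_mem_nil, or_false] at hr
  rcases hr with rfl | rfl | rfl | rfl | rfl <;> dsimp only <;> positivity

theorem add_three_lt_sq_sub_one_mul_pow {q n : ℕ} (hq : 3 ≤ q) (hne : ¬(q = 3 ∧ n = 0)) :
    (q + 3 : ℚ) < (q - 1) ^ 2 * q ^ (2 * n) := by
  have hq' : (3 : ℚ) ≤ q := by exact_mod_cast hq
  rcases Nat.eq_zero_or_pos n with rfl | hn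
  · have hq4 : (4 : ℚ) ≤ q := by exact_mod_cast (show 4 ≤ q by lia)
    rw [mul_zero, pow_zero]
    nlinarith
  · calc (q + 3 : ℚ) < (q - 1) ^ 2 * q ^ 2 := by nlinarith
      _ ≤ (q - 1) ^ 2 * q ^ (2 * n) := by
        gcongr
        · linarith
        · lia

theorem tableMultiplicity_weightTableThree_zero {q n : ℕ} (hq : 3 ≤ q)
    (h : (q + 3 : ℚ) < (q - 1) ^ 2 * q ^ (2 * n)) :
    tableMultiplicity (weightTableThree q (4 * (n + 1))) 0 = 1 := by
  have hq3 : (3 : ℚ) ≤ q := by exact_mod_cast hq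
  have h1 : (0 : ℚ) < q - 1 := by linarith
  refine tableMultiplicity_zero (fun r hr => ?_) 1
  rw [show 4 * (n + 1) - 2 = 2 * n + 2 * n + 2 by lia,
    show 4 * (n + 1) / 2 - 1 = 2 * n + 1 by lia,
    show 4 * (n + 1) / 2 = 2 * n + 2 by lia] at hr
  have hZ : (0 : ℚ) < q ^ (2 * n) := by positivity
  simp only [List.mem_cons, List.not_mem_nil, or_false, pow_add] at hr
  generalize (q : ℚ) ^ (2 * n) = Z at *
  have pos {a : ℚ} (ha : a ≤ q + 3) :
      0 < ((q : ℚ) - 1) ^ 2 / 2 * (Z * Z * q ^ 2) - a / 2 * (Z * q ^ 2) := by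
    calc 0 < Z * q ^ 2 / 2 * ((q - 1) ^ 2 * Z - a) := mul_pos (by positivity) (by linarith)
      _ = _ := by ring
  rcases hr with rfl | rfl | rfl | rfl | rfl | rfl <;> dsimp only
  · refine (pos (a := (q ^ 2 - 1) / q) ?_).trans_eq ?_
    · rw [div_le_iff₀ (by linarith)]
      linarith
    · field_simp
  · positivity
  · exact pos (by linarith)
  · exact pos le_rfl
  · exact pos (by linarith)
  · exact (pos (a := 2) (by linarith)).trans_eq (by ring)

theorem tableMultiplicity_weightTable_zero {q n : ℕ} (hq : 3 ≤ q) (hne : ¬(q = 3 ∧ n = 0)) :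
    tableMultiplicity (weightTable q (4 * (n + 1))) 0 = 1 := by
  rw [weightTable]
  split_ifs with h
  · exact tableMultiplicity_weightTableOne_zero hq _
  · exact tableMultiplicity_weightTableThree_zero hq (add_three_lt_sq_sub_one_mul_pow hq hne)

end WeightTables

section TraceCodeTables

variable (k F : Type*) [Field k] [Fintype k] [DecidableEq k] [Field F] [Finite F] [Algebra k F]
  {n : ℕ} (hn : Module.finrank k F = 4 * (n + 1)) (h2 : ringChar k ≠ 2)
include hn h2

local notation "q" => Fintype.card k

theorem sum_oppositeClassTable_normTraceForm (g : ℚ → ℚ) :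
    ((oppositeClassTable (normTraceForm k F) ((q : ℚ) ^ (2 * n))).map fun r => r.2 * g r.1).sum
      = ((weightTable q (4 * (n + 1))).map fun r => r.2 * g r.1).sum := by
  have hq : (q : ℚ) ≠ 0 := Nat.cast_ne_zero.mpr Fintype.card_ne_zero
  have cancel (x : ℚ) : (q - 1) / q * (q ^ 2 * x) = (q - 1) * q * x := by field_simp
  have half : 4 * (n + 1) / 2 = 2 * n + 2 := by lia
  have h_odd := FiniteField.odd_card_of_char_ne_two h2
  rcases (by lia : q % 4 = 1 ∨ q % 4 = 3) with h | h
  · have hη : quadraticChar k (-1) = 1 := by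
      rw [quadraticChar_neg_one h2, ZMod.χ₄_nat_one_mod_four h]
    rw [weightTable, if_pos h, oppositeClassTable, weightTableOne]
    simp only [oppositeClassWeight, card_ker_polarBilin_normTraceForm k F hn h2, hη, half, cancel,
      Nat.cast_pow, List.map_cons, List.map_nil, List.sum_cons, List.sum_nil,
      show 4 * (n + 1) - 2 = 4 * n + 2 by lia, show 4 * (n + 1) - 3 = 4 * n + 1 by lia,
      show 4 * (n + 1) - 4 = 4 * n by lia, show 2 * n + 2 - 1 = 2 * n + 1 by lia,
      show 2 * n + 2 - 2 = 2 * n by lia]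
    push_cast
    ring_nf
  · have hη : quadraticChar k (-1) = -1 := by
      rw [quadraticChar_neg_one h2, ZMod.χ₄_nat_three_mod_four h]
    rw [weightTable, if_neg (by lia), oppositeClassTable, weightTableThree]
    simp only [oppositeClassWeight, card_ker_polarBilin_normTraceForm k F hn h2, hη, half, cancel,
      Nat.cast_pow, List.map_cons, List.map_nil, List.sum_cons, List.sum_nil,
      show 4 * (n + 1) - 2 = 4 * n + 2 by lia,
      show 4 * (n + 1) - 4 = 4 * n by lia, show 2 * n + 2 - 1 = 2 * n + 1 by lia,
      show 2 * n + 2 - 2 = 2 * n by lia]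
    push_cast
    ring_nf

end TraceCodeTables

section NormTraceCode

open Finset

variable {k F : Type*} [Field k] [Fintype k] [DecidableEq k] [Field F] [Fintype F] [Algebra k F]
  {n : ℕ} (hn : Module.finrank k F = 4 * (n + 1)) (h2 : ringChar k ≠ 2)
  (hF : (Module.finrank k F : k) ≠ 0)
include hn h2 hF

local notation "q" => Fintype.card k

theorem cast_card_normTraceSet :
    (#(normTraceSet k F) : ℚ) = ((q : ℚ) - 1) / 2 * (q : ℚ) ^ (4 * (n + 1) - 1)
      - (1 - quadraticChar k (-1) * (q : ℚ)) / 2 * (q : ℚ) ^ (4 * (n + 1) / 2) := by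
  rw [card_normTraceSet k F h2, (hasEvenRankLevels_normTraceForm k F hn h2
    ).card_preimage_oppositeClass h2 (normTraceForm_half_ne_zero k F h2 hF),
    card_ker_polarBilin_normTraceForm k F hn h2, show 4 * (n + 1) - 1 = 4 * n + 3 by lia,
    show 4 * (n + 1) / 2 = 2 * n + 2 by lia]
  push_cast
  ring

theorem card_hammingNorm_traceWord_eq (w : ℕ) :
    (#{a | hammingNorm (traceWord k (normTraceSet k F) a) = w} : ℚ)
      = tableMultiplicity (weightTable q (4 * (n + 1))) w := by
  let traceDual := (Algebra.traceForm k F).toDual (traceForm_nondegenerate k F)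
  have traceDual_apply (a : F) : traceDual a = Algebra.traceForm k F a := rfl
  have : Fintype (Module.Dual k F) := Fintype.ofEquiv F traceDual.toEquiv
  let g (x : ℚ) : ℚ := if x = w then 1 else 0
  have dual := ((hasEvenRankLevels_normTraceForm k F hn h2
    ).sum_comp_translateWeight_oppositeClass h2 (normTraceForm_half_ne_zero k F h2 hF) g).trans
      (sum_oppositeClassTable_normTraceForm k F hn h2 g)
  rw [← traceDual.toEquiv.sum_comp] at dual
  simp only [hammingNorm_traceWord_normTraceSet k F h2, natCast_card_filter, tableMultiplicity]
  simpa [g, traceDual_apply] using dual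

theorem encard_wordCount_ne_zero_le :
    {w | w ≠ 0 ∧ wordCount (traceWord k (normTraceSet k F)).range w ≠ 0}.encard ≤ 6 := by
  refine le_trans (Set.encard_le_encard ?_) (encard_weightTable_ne_zero_le q (4 * (n + 1)))
  rintro w ⟨hw0, hw⟩
  refine ⟨hw0, ?_⟩
  rw [← card_hammingNorm_traceWord_eq hn h2 hF, ← card_ker_mul_wordCount_range]
  exact mul_ne_zero (Nat.cast_ne_zero.mpr Nat.card_pos.ne') (Nat.cast_ne_zero.mpr hw)

variable (hne : ¬(Fintype.card k = 3 ∧ n = 0))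
include hne

theorem card_ker_traceWord : Nat.card (traceWord k (normTraceSet k F)).ker = 1 := by
  have h_odd := FiniteField.odd_card_of_char_ne_two h2
  have hq : 1 < q := Fintype.one_lt_card
  rw [card_ker_eq_card_hammingNorm_eq_zero, ← Nat.cast_inj (R := ℚ),
    card_hammingNorm_traceWord_eq hn h2 hF, tableMultiplicity_weightTable_zero (by lia) hne,
    Nat.cast_one]

theorem finrank_range_traceWord :
    Module.finrank k (traceWord k (normTraceSet k F)).range = 4 * (n + 1) := by
  have := (Nat.card_eq_one_iff_unique.mp (card_ker_traceWord hn h2 hF hne)).1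
  rw [LinearMap.finrank_range_of_inj
    (LinearMap.ker_eq_bot.mp (Submodule.eq_bot_of_subsingleton)), hn]

theorem wordCount_range_traceWord (w : ℕ) :
    (wordCount (traceWord k (normTraceSet k F)).range w : ℚ)
      = tableMultiplicity (weightTable q (4 * (n + 1))) w := by
  rw [← card_hammingNorm_traceWord_eq hn h2 hF, ← card_ker_mul_wordCount_range,
    card_ker_traceWord hn h2 hF hne, Nat.cast_one, one_mul]

end NormTraceCode

theorem theorem9_general {k F : Type*} [Field k] [Fintype k] [DecidableEq k] [Field F] [Fintype F]
    [Algebra k F] (h2 : ringChar k ≠ 2) {q e : ℕ} (hk : Fintype.card k = q)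
    (hF : Module.finrank k F = e) (he : 4 ∣ e) (hek : (e : k) ≠ 0) :
    ((normTraceSet k F).card : ℚ) = ((q : ℚ) - 1) / 2 * (q : ℚ) ^ (e - 1)
        - (1 - quadraticChar k (-1) * (q : ℚ)) / 2 * (q : ℚ) ^ (e / 2) ∧
    {w | w ≠ 0 ∧ wordCount (traceWord k (normTraceSet k F)).range w ≠ 0}.encard ≤ 6 ∧
    (¬(q = 3 ∧ e = 4) →
      Module.finrank k (traceWord k (normTraceSet k F)).range = e ∧
      (q % 4 = 1 → ∀ w, (wordCount (traceWord k (normTraceSet k F)).range w : ℚ)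
        = tableMultiplicity (weightTableOne q e) w) ∧
      (q % 4 = 3 → ∀ w, (wordCount (traceWord k (normTraceSet k F)).range w : ℚ)
        = tableMultiplicity (weightTableThree q e) w)) := by
  have e_pos : 0 < e := hF ▸ Module.finrank_pos
  obtain ⟨n, hn⟩ : ∃ n, e = 4 * (n + 1) := ⟨e / 4 - 1, by lia⟩
  subst hk hn
  rw [← hF] at hek
  refine ⟨cast_card_normTraceSet hF h2 hek, encard_wordCount_ne_zero_le hF h2 hek, fun hne => ?_⟩
  have hne' : ¬(Fintype.card k = 3 ∧ n = 0) := by lia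
  have counts := wordCount_range_traceWord hF h2 hek hne'
  refine ⟨finrank_range_traceWord hF h2 hek hne', fun h => ?_, fun h => ?_⟩
  · rwa [weightTable, if_pos h] at counts
  · rwa [weightTable, if_neg (by lia)] at counts

theorem mem_cyclotomicClass {p : ℕ} [Fact p.Prime] {i : Fin 2} {s : ZMod p} :
    s ∈ cyclotomicClass p i ↔ quadraticChar (ZMod p) s = (-1) ^ (i : ℕ) := by
  fin_cases i
  · simp only [cyclotomicClass, Fin.zero_eta, if_true, Set.mem_ofPred_eq, pow_zero]
    constructor
    · rintro ⟨h0, h⟩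
      exact (quadraticChar_one_iff_isSquare h0).mpr h
    · intro h
      have h0 : s ≠ 0 := by
        rintro rfl
        simp at h
      exact ⟨h0, (quadraticChar_one_iff_isSquare h0).mp h⟩
  · simp only [cyclotomicClass, Fin.mk_one, one_ne_zero, if_false, Set.mem_ofPred_eq, pow_one]
    exact quadraticChar_neg_one_iff_not_isSquare.symm

theorem definingSet_eq_normTraceSet {p : ℕ} [Fact p.Prime] {F : Type*} [Field F] [Fintype F]
    [Algebra (ZMod p) F] {i : Fin 2}
    (hi : quadraticChar (ZMod p) (Module.finrank (ZMod p) F) = (-1) ^ (1 - (i : ℕ))) :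
    definingSet p F i = normTraceSet (ZMod p) F := by
  have sign : (-1 : ℤ) ^ (i : ℕ) = -(-1) ^ (1 - (i : ℕ)) := by fin_cases i <;> rfl
  ext x
  simp only [definingSet, normTraceSet, Finset.mem_filter_univ, mem_cyclotomicClass, sign, hi,
    ZMod.card]

theorem theorem9 (p : ℕ) [Fact p.Prime] (hp : p ≠ 2) (e : ℕ) (he : 4 ∣ e) (i : Fin 2)
    (hi : legendreSym p (e : ℤ) = (-1) ^ (1 - (i : ℕ)))
    (F : Type*) [Field F] [Fintype F] [Algebra (ZMod p) F] (hF : Fintype.card F = p ^ e) :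
    ((definingSet p F i).card : ℚ)
        = ((p : ℚ) - 1) / 2 * (p : ℚ) ^ (e - 1)
          - (1 - (quadraticChar (ZMod p) (-1) : ℚ) * (p : ℚ)) / 2 * (p : ℚ) ^ (e / 2) ∧
    {w : ℕ | w ≠ 0 ∧ weightCount (traceCode p (definingSet p F i)) w ≠ 0}.encard ≤ 6 ∧
    (¬ (p = 3 ∧ e = 4) →
      Module.finrank (ZMod p) (traceCode p (definingSet p F i)) = e ∧
      (p % 4 = 1 → ∀ w : ℕ, (weightCount (traceCode p (definingSet p F i)) w : ℚ)
        = tableMultiplicity (weightTableOne p e) w) ∧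
      (p % 4 = 3 → ∀ w : ℕ, (weightCount (traceCode p (definingSet p F i)) w : ℚ)
        = tableMultiplicity (weightTableThree p e) w)) := by
  have he' : Module.finrank (ZMod p) F = e := by
    have h := Module.card_eq_pow_finrank (K := ZMod p) (V := F)
    rw [hF, ZMod.card] at h
    exact (Nat.pow_right_injective (Fact.out : p.Prime).two_le h).symm
  have hη : quadraticChar (ZMod p) (Module.finrank (ZMod p) F) = (-1) ^ (1 - (i : ℕ)) := by
    rw [he', ← hi, legendreSym, Int.cast_natCast]
  have e_ne_zero : (e : ZMod p) ≠ 0 := by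
    intro h
    rw [he', h, quadraticChar_zero] at hη
    exact pow_ne_zero _ (by norm_num) hη.symm
  rw [definingSet_eq_normTraceSet hη]
  exact theorem9_general (by rwa [ZMod.ringChar_zmod_n]) (ZMod.card p) he' he e_ne_zero
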